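/- Let $\Gamma=(V,E)$ be a finite simple graph and let $(G_v)_{v\in V}$ be a family of nontrivial finite groups. Let $G$ be their graph product over $\Gamma$, that is, the quotient of the free product of the groups $G_v$ by the normal closure of all commutators $g^{-1}h^{-1}gh$ with $g\in G_u$, $h\in G_v$ and $\{u,v\}\in E$. For $A\subseteq V$ let $G(A)$ be the subgroup of $G$ generated by the images of the groups $G_a$, $a\in A$. Call $A\subseteq V$ complete if any two distinct elements of $A$ are adjacent; in that case $G(A)$ is finite. For a finite subgroup $F$ of $G$ let $[F]$ be its conjugacy class, and order the set $\mathcal F$ of conjugacy classes of finite subgroups of $G$ by $[F]\preceq[F']$ if and only if $F\subseteq gF'g^{-1}$ for some $g\in G$; this is a partial order. Let $A,B\subseteq V$ be complete. If $A\cup B$ is complete, then $[G(A\cup B)]$ is the least upper bound of $[G(A)]$ and $[G(B)]$ in $(\mathcal F,\preceq)$. If $A\cup B$ is not complete, then $[G(A)]$ and $[G(B)]$ have no common upper bound in $(\mathcal F,\preceq)$. -/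

import Mathlib

/-- The commutators `g⁻¹ h⁻¹ g h` in the free product of the groups `G v`, where `g` and `h` are
taken from the vertex groups of two adjacent vertices. -/
def graphCommutators {V : Type*} (Γ : SimpleGraph V) (G : V → Type*) [∀ v, Group (G v)] :
    Set (Monoid.CoprodI G) :=
  {x | ∃ u v : V, Γ.Adj u v ∧ ∃ (g : G u) (h : G v),
    x = (Monoid.CoprodI.of g)⁻¹ * (Monoid.CoprodI.of h)⁻¹ *
      Monoid.CoprodI.of g * Monoid.CoprodI.of h}

/-- The graph product of the groups `G v` over `Γ`: the free product of the vertex groups modulo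
the normal closure of the commutators of elements of adjacent vertex groups. -/
abbrev GraphProduct {V : Type*} (Γ : SimpleGraph V) (G : V → Type*) [∀ v, Group (G v)] :=
  Monoid.CoprodI G ⧸ Subgroup.normalClosure (graphCommutators Γ G)

namespace GraphProduct

/-- The canonical homomorphism from a vertex group to the graph product. -/
def of {V : Type*} (Γ : SimpleGraph V) (G : V → Type*) [∀ v, Group (G v)] (v : V) :
    G v →* GraphProduct Γ G :=
  (QuotientGroup.mk' (Subgroup.normalClosure (graphCommutators Γ G))).comp Monoid.CoprodI.of

/-- The subgroup `G(A)` of the graph product generated by the (images of the) vertex groups `G a`,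
`a ∈ A`. -/
def sub {V : Type*} (Γ : SimpleGraph V) (G : V → Type*) [∀ v, Group (G v)] (A : Set V) :
    Subgroup (GraphProduct Γ G) :=
  Subgroup.closure (⋃ a ∈ A, Set.range (of Γ G a))

theorem commute_of_adj {V : Type*} {Γ : SimpleGraph V} {G : V → Type*} [∀ v, Group (G v)]
    {u v : V} (huv : Γ.Adj u v) (g : G u) (h : G v) :
    of Γ G u g * of Γ G v h = of Γ G v h * of Γ G u g := by
  have hm : (Monoid.CoprodI.of g)⁻¹ * (Monoid.CoprodI.of h)⁻¹ *
      Monoid.CoprodI.of g * Monoid.CoprodI.of h ∈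
        Subgroup.normalClosure (graphCommutators Γ G) :=
    Subgroup.subset_normalClosure ⟨u, v, huv, g, h, rfl⟩
  have h1 := (QuotientGroup.eq_one_iff _).2 hm
  have h2 : (of Γ G u g)⁻¹ * (of Γ G v h)⁻¹ * of Γ G u g * of Γ G v h = 1 := h1
  have h3 : (of Γ G v h * of Γ G u g)⁻¹ * (of Γ G u g * of Γ G v h) = 1 := by
    rw [← h2]; group
  exact (inv_mul_eq_one.1 h3).symm

/-- If `A` is complete, finite, and its vertex groups are finite, then `G(A)` is finite. -/
theorem finite_sub {V : Type*} [Finite V] (Γ : SimpleGraph V) (G : V → Type*)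
    [∀ v, Group (G v)] [∀ v, Finite (G v)] (A : Set V) (hA : Γ.IsClique A) :
    Finite (sub Γ G A) := by
  induction A, A.toFinite using Set.Finite.induction_on with
  | empty =>
    have h : sub Γ G ∅ = ⊥ := by simp [sub]
    rw [h]
    infer_instance
  | @insert a s ha hs ih =>
    have ih' : Finite (sub Γ G s) := ih (hA.subset (Set.subset_insert a s))
    have h : sub Γ G (insert a s) = (of Γ G a).range ⊔ sub Γ G s := by
      rw [sub, Set.biUnion_insert, Subgroup.closure_union, ← MonoidHom.coe_range,
        Subgroup.closure_eq]
      rfl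
    have hle : (of Γ G a).range ≤ Subgroup.centralizer (sub Γ G s : Set (GraphProduct Γ G)) := by
      rw [Subgroup.le_centralizer_iff]
      refine (Subgroup.closure_le _).2 ?_
      intro x hx
      simp only [Set.mem_iUnion] at hx
      obtain ⟨b, hb, y, rfl⟩ := hx
      rintro _ ⟨z, rfl⟩
      have hab : a ≠ b := by
        rintro rfl
        exact ha hb
      exact commute_of_adj (hA (Set.mem_insert a s) (Set.mem_insert_of_mem a hb) hab) z y
    have hn : (of Γ G a).range ≤ Subgroup.normalizer (sub Γ G s : Set (GraphProduct Γ G)) :=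
      hle.trans (Subgroup.centralizer_le_normalizer _)
    have hset : ((sub Γ G (insert a s) : Subgroup (GraphProduct Γ G)) :
        Set (GraphProduct Γ G)).Finite := by
      rw [h, Subgroup.coe_mul_of_left_le_normalizer_right _ _ hn]
      exact Set.Finite.mul (Set.finite_range (of Γ G a)) (Set.toFinite _)
    exact hset.to_subtype

end GraphProduct

/-- The preorder on the finite subgroups of `H` given by `A ≼ B` if and only if
`A ⊆ g B g⁻¹` for some `g`. -/
def SubConj {H : Type*} [Group H] (A B : {K : Subgroup H // Finite K}) : Prop :=
  ∃ g : H, A.1 ≤ B.1.map (MulAut.conj g).toMonoidHom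

/-- Conjugacy of finite subgroups: `A = g B g⁻¹` for some `g`. -/
def ConjFin {H : Type*} [Group H] (A B : {K : Subgroup H // Finite K}) : Prop :=
  ∃ g : H, A.1 = B.1.map (MulAut.conj g).toMonoidHom

theorem map_conj_map_conj {H : Type*} [Group H] (A : Subgroup H) (g h : H) :
    (A.map (MulAut.conj g).toMonoidHom).map (MulAut.conj h).toMonoidHom =
      A.map (MulAut.conj (h * g)).toMonoidHom := by
  rw [Subgroup.map_map]
  congr 1
  ext x
  simp

theorem map_conj_one {H : Type*} [Group H] (A : Subgroup H) :
    A.map (MulAut.conj (1 : H)).toMonoidHom = A := by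
  ext x
  simp

theorem SubConj.trans {H : Type*} [Group H] {A B C : {K : Subgroup H // Finite K}}
    (h₁ : SubConj A B) (h₂ : SubConj B C) : SubConj A C := by
  obtain ⟨g, hg⟩ := h₁
  obtain ⟨k, hk⟩ := h₂
  refine ⟨g * k, ?_⟩
  rw [← map_conj_map_conj]
  exact hg.trans (Subgroup.map_mono hk)

theorem ConjFin.subConj {H : Type*} [Group H] {A B : {K : Subgroup H // Finite K}}
    (h : ConjFin A B) : SubConj A B := by
  obtain ⟨g, hg⟩ := h
  exact ⟨g, hg.le⟩

theorem ConjFin.symm {H : Type*} [Group H] {A B : {K : Subgroup H // Finite K}}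
    (h : ConjFin A B) : ConjFin B A := by
  obtain ⟨g, hg⟩ := h
  refine ⟨g⁻¹, ?_⟩
  rw [hg, map_conj_map_conj, inv_mul_cancel, map_conj_one]

theorem SubConj.card_le {H : Type*} [Group H] {A B : {K : Subgroup H // Finite K}}
    (h : SubConj A B) : Nat.card A.1 ≤ Nat.card B.1 := by
  obtain ⟨g, hg⟩ := h
  have := A.2
  have := B.2
  have hc : Nat.card (B.1.map (MulAut.conj g).toMonoidHom) = Nat.card B.1 :=
    Subgroup.card_map_of_injective (MulAut.conj g).injective
  have hf : Finite (B.1.map (MulAut.conj g).toMonoidHom) :=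
    Nat.finite_of_card_ne_zero (hc ▸ Nat.card_pos.ne')
  exact (Nat.card_le_card_of_injective _ (Subgroup.inclusion_injective hg)).trans hc.le

theorem SubConj.antisymm {H : Type*} [Group H] {A B : {K : Subgroup H // Finite K}}
    (h₁ : SubConj A B) (h₂ : SubConj B A) : ConjFin A B := by
  have hle := h₂.card_le
  obtain ⟨g, hg⟩ := h₁
  have := A.2
  have := B.2
  have hc : Nat.card (B.1.map (MulAut.conj g).toMonoidHom) = Nat.card B.1 :=
    Subgroup.card_map_of_injective (MulAut.conj g).injective
  have hf : Finite (B.1.map (MulAut.conj g).toMonoidHom) :=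
    Nat.finite_of_card_ne_zero (hc ▸ Nat.card_pos.ne')
  exact ⟨g, Subgroup.eq_of_le_of_card_ge hg (hc.le.trans hle)⟩

/-- Conjugacy as an equivalence relation on the finite subgroups of `H`. -/
def conjFinSetoid (H : Type*) [Group H] : Setoid {K : Subgroup H // Finite K} where
  r := ConjFin
  iseqv :=
    { refl := fun A => ⟨1, (map_conj_one A.1).symm⟩
      symm := ConjFin.symm
      trans := fun h₁ h₂ =>
        (h₁.subConj.trans h₂.subConj).antisymm (h₂.symm.subConj.trans h₁.symm.subConj) }

/-- The conjugacy classes of finite subgroups of `H`. -/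
def FinSubgroupClass (H : Type*) [Group H] : Type _ := Quotient (conjFinSetoid H)

namespace FinSubgroupClass

/-- The conjugacy class `[F]` of a finite subgroup `F`. -/
def mk {H : Type*} [Group H] (F : Subgroup H) (hF : Finite F) : FinSubgroupClass H :=
  Quotient.mk (conjFinSetoid H) ⟨F, hF⟩

/-- `[A] ≼ [B]` if and only if `A ⊆ g B g⁻¹` for some `g`. -/
instance {H : Type*} [Group H] : PartialOrder (FinSubgroupClass H) where
  le := Quotient.lift₂ (s₁ := conjFinSetoid H) (s₂ := conjFinSetoid H) SubConj
    (fun _ _ _ _ h₁ h₂ => propext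
      ⟨fun h => h₁.symm.subConj.trans (h.trans h₂.subConj),
        fun h => h₁.subConj.trans (h.trans h₂.symm.subConj)⟩)
  le_refl := by
    rintro ⟨A⟩
    exact ⟨1, (map_conj_one A.1).ge⟩
  le_trans := by
    rintro ⟨A⟩ ⟨B⟩ ⟨C⟩ h₁ h₂
    exact SubConj.trans h₁ h₂
  le_antisymm := by
    rintro ⟨A⟩ ⟨B⟩ h₁ h₂
    exact Quotient.sound (s := conjFinSetoid H) (SubConj.antisymm h₁ h₂)

theorem mk_le_mk {H : Type*} [Group H] {A B : Subgroup H} (hA : Finite A) (hB : Finite B) :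
    mk A hA ≤ mk B hB ↔ ∃ g : H, A ≤ B.map (MulAut.conj g).toMonoidHom :=
  Iff.rfl

end FinSubgroupClass

/-- The class `[G(A)]`, for a complete set `A` of vertices, in the poset of conjugacy classes of
finite subgroups of the graph product. -/
def GraphProduct.cls {V : Type*} [Finite V] (Γ : SimpleGraph V) (G : V → Type*)
    [∀ v, Group (G v)] [∀ v, Finite (G v)] (A : Set V) (hA : Γ.IsClique A) :
    FinSubgroupClass (GraphProduct Γ G) :=
  FinSubgroupClass.mk (GraphProduct.sub Γ G A) (GraphProduct.finite_sub Γ G A hA)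

/-! The crux is that every finite subgroup of `G` is conjugate into some `G(C)` with `C` complete.
Build up the vertex set one vertex `v` at a time. The group `G(W ∪ {v})` embeds in a semidirect
product: a free product of copies of `G v`, indexed by cosets of the subgroup generated by the link
of `v` in `W`, is acted on by permuting the copies. This semidirect product acts affinely on the
free product and preserves the distance `syllables (p⁻¹ * q)`. A finite subgroup has a set of
centres, the points minimizing the radius of its orbit of `1`. A point strictly between two centres
would have smaller radius, so centres are at distance at most one. Hence the subgroup fixes a point,
and is conjugate into `G(W)`, or stabilizes a coset of one factor, and is conjugate into the star
subgroup `G v · G(link)`. In the second case, projecting to `G(link)` allows induction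
(`exists_conj_mem_sub_clique`). An upper bound is thus represented by some `F ≤ G(C)`. If `F`
contains a conjugate of a vertex group, projections to vertex groups show that the vertex lies in
`C` and that `F` contains the vertex group itself (`mem_and_of_mem_of_conj_mem`). So `A ∪ B ⊆ C` and
`G(A ∪ B) ≤ F`, which gives both claims. -/

namespace Monoid.CoprodI

/-! ### The syllable metric on a free product. -/

section Syllables

variable {ι : Type*} {N : ι → Type*} [∀ i, Group (N i)]

open Classical in
/-- The number of syllables in the reduced word of an element of a free product. -/
noncomputable def syllables (k : CoprodI N) : ℕ := (Word.equiv k).toList.length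

theorem syllables_prod (w : Word N) : syllables w.prod = w.toList.length := by
  classical
  rw [syllables]
  congr 2
  exact Word.equiv.apply_symm_apply w

theorem exists_word_prod_eq (k : CoprodI N) :
    ∃ w : Word N, w.prod = k ∧ syllables k = w.toList.length := by
  classical
  have h : (Word.equiv k).prod = k := Word.equiv.symm_apply_apply k
  exact ⟨Word.equiv k, h, by rw [← syllables_prod, h]⟩

theorem eq_of_of_syllables_le_one {k : CoprodI N} (hk : syllables k ≤ 1) :
    k = 1 ∨ ∃ i, ∃ m : N i, m ≠ 1 ∧ k = of m := by
  obtain ⟨⟨l, h1, h2⟩, rfl, hl⟩ := exists_word_prod_eq k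
  rw [hl] at hk
  rcases l with _ | ⟨a, _ | ⟨b, t⟩⟩
  · exact Or.inl rfl
  · exact Or.inr ⟨a.1, a.2, h1 a (by simp), by simp [Word.prod]⟩
  · simp at hk

theorem syllables_of {i : ι} {m : N i} (hm : m ≠ 1) : syllables (of m) = 1 := by
  have h := syllables_prod (⟨[⟨i, m⟩], by simpa using hm, by simp⟩ : Word N)
  simpa [Word.prod] using h

theorem syllables_one : syllables (1 : CoprodI N) = 0 :=
  syllables_prod (Word.empty : Word N)

/-- Nontrivial letters from different factors would form a reduced word of length two. -/
theorem idx_eq_of_of_inv_mul_of_syllables_le_one {i j : ι} {m : N i} {n : N j} (hm : m ≠ 1)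
    (hn : n ≠ 1) (h : syllables ((of m)⁻¹ * of n) ≤ 1) : i = j := by
  by_contra hij
  have h2 := syllables_prod
    (⟨[⟨i, m⁻¹⟩, ⟨j, n⟩], by simpa using ⟨hm, hn⟩, by simpa using hij⟩ : Word N)
  simp [Word.prod, map_inv] at h2
  omega

/-- A point strictly between `p` and `q` separates every point from `p` or from `q`. -/
theorem exists_syllables_lt_max {p q : CoprodI N} (h : 2 ≤ syllables (p⁻¹ * q)) :
    ∃ r : CoprodI N, ∀ s : CoprodI N,
      syllables (r⁻¹ * s) < max (syllables (p⁻¹ * s)) (syllables (q⁻¹ * s)) := by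
  obtain ⟨⟨l, h1, h2⟩, hw, hl⟩ := exists_word_prod_eq (p⁻¹ * q)
  rw [hl] at h
  rcases l with _ | ⟨a, _ | ⟨b, t⟩⟩
  · simp at h
  · simp at h
  -- The separating point is one syllable from `p` along the reduced word from `p` to `q`; below,
  -- `u` is the reduced word from it to `s`.
  · refine ⟨p * of a.2, fun s => ?_⟩
    rw [List.isChain_cons_cons] at h2
    obtain ⟨u, hu, hul⟩ := exists_word_prod_eq ((p * of a.2)⁻¹ * s)
    have hp : p⁻¹ * s = of a.2 * u.prod := by rw [hu]; group
    have hq : q⁻¹ * s = (((b :: t).map fun x => of x.2).prod)⁻¹ * u.prod := by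
      have : q = p * (of a.2 * ((b :: t).map fun x => of x.2).prod) := by
        have hw' : of a.2 * ((b :: t).map fun x => of x.2).prod = p⁻¹ * q := by
          simpa [Word.prod] using hw
        rw [hw']; group
      rw [hu, this]; group
    rw [lt_max_iff, hul]
    -- If `u` starts in the factor of `a`, it cannot cancel against `b`, so the inverted tail
    -- followed by `u` is reduced and `s` is farther from `q`. Otherwise `a` followed by `u` is
    -- reduced and `s` is farther from `p`.
    by_cases hidx : u.fstIdx = some a.1
    · right
      rw [hq]
      let v : Word N :=
        ⟨((b :: t).reverse.map fun x => ⟨x.1, x.2⁻¹⟩) ++ u.toList, by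
          intro x hx
          rcases List.mem_append.1 hx with hx | hx
          · obtain ⟨y, hy, rfl⟩ := List.mem_map.1 hx
            rw [List.mem_reverse] at hy
            exact inv_ne_one.2 (h1 y (List.mem_cons_of_mem _ hy))
          · exact u.ne_one x hx, by
          refine List.IsChain.append ?_ u.chain_ne ?_
          · rw [List.isChain_map, List.isChain_reverse]
            exact h2.2.imp fun _ _ hne => hne.symm
          · intro x hx y hy
            have hx' : x = ⟨b.1, b.2⁻¹⟩ := by simpa using hx.symm
            have hy' : y.1 = a.1 := by
              rw [Word.fstIdx, Option.mem_def.1 hy] at hidx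
              simpa using hidx
            rw [hx', hy']
            exact h2.1.symm⟩
      have hv : v.prod = (((b :: t).map fun x => of x.2).prod)⁻¹ * u.prod := by
        simp only [v, Word.prod, List.map_append, List.prod_append, List.map_map]
        rw [List.prod_inv_reverse, List.map_map, List.map_reverse]
        congr 3
      rw [← hv, syllables_prod]
      simp [v]
      omega
    · left
      rw [hp, ← Word.prod_cons _ _ u (h1 a (by simp)) hidx, syllables_prod]
      simp [Word.cons]

end Syllables

/-! ### Affine isometries of a free product and their finite groups. -/

section Permute

variable {X H : Type*} (M : Type*) [Group M] [Group H] [MulAction H X]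

/-- The endomorphism of a free product of copies of `M`, indexed by an `H`-set, that permutes the
copies by `h`. -/
def permuteHom (h : H) : CoprodI (fun _ : X => M) →* CoprodI (fun _ : X => M) :=
  lift fun x => of (M := fun _ : X => M) (i := h • x)

theorem permuteHom_of (h : H) (x : X) (m : M) :
    permuteHom M h (of (M := fun _ : X => M) (i := x) m) =
      of (M := fun _ : X => M) (i := h • x) m :=
  lift_of _ _

theorem permuteHom_one : permuteHom M (1 : H) = MonoidHom.id (CoprodI fun _ : X => M) := by
  refine ext_hom _ _ fun x => MonoidHom.ext fun m => ?_
  rw [MonoidHom.comp_apply, permuteHom_of, one_smul]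
  rfl

theorem permuteHom_mul (g h : H) :
    permuteHom (X := X) M (g * h) = (permuteHom M g).comp (permuteHom M h) := by
  refine ext_hom _ _ fun x => MonoidHom.ext fun m => ?_
  rw [MonoidHom.comp_apply, permuteHom_of, MonoidHom.comp_apply, MonoidHom.comp_apply,
    permuteHom_of, permuteHom_of, mul_smul]

variable (X H) in
/-- The action of `H` on a free product of copies of `M` indexed by an `H`-set, by permutation of
the copies. -/
def permute : H →* MulAut (CoprodI fun _ : X => M) where
  toFun h := MonoidHom.toMulEquiv (permuteHom M h) (permuteHom M h⁻¹)
    (by rw [← permuteHom_mul, inv_mul_cancel, permuteHom_one])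
    (by rw [← permuteHom_mul, mul_inv_cancel, permuteHom_one])
  map_one' := MulEquiv.ext fun k => DFunLike.congr_fun (permuteHom_one M) k
  map_mul' g h := MulEquiv.ext fun k => DFunLike.congr_fun (permuteHom_mul M g h) k

theorem permute_of (h : H) (x : X) (m : M) :
    permute X H M h (of (M := fun _ : X => M) (i := x) m) =
      of (M := fun _ : X => M) (i := h • x) m :=
  permuteHom_of M h x m

/-- Since `h` acts injectively on indices, relabelling keeps a reduced word reduced. -/
theorem syllables_permute (h : H) (k : CoprodI fun _ : X => M) :
    syllables (permute X H M h k) = syllables k := by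
  obtain ⟨w, rfl, hw⟩ := exists_word_prod_eq k
  let v : Word fun _ : X => M :=
    ⟨w.toList.map fun x => ⟨h • x.1, x.2⟩, by
      intro x hx
      obtain ⟨y, hy, rfl⟩ := List.mem_map.1 hx
      exact w.ne_one y hy, by
      rw [List.isChain_map]
      exact w.chain_ne.imp fun _ _ hne => (MulAction.injective h).ne hne⟩
  have hv : v.prod = permute X H M h w.prod := by
    simp only [v, Word.prod, List.map_map, map_list_prod]
    congr 2
  rw [← hv, syllables_prod, hw]
  simp [v]

variable {M}

/-- The affine action of the semidirect product on the free product. -/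
def affine (f : (CoprodI fun _ : X => M) ⋊[permute X H M] H) (k : CoprodI fun _ : X => M) :
    CoprodI fun _ : X => M :=
  f.left * permute X H M f.right k

theorem affine_mul (f g : (CoprodI fun _ : X => M) ⋊[permute X H M] H)
    (k : CoprodI fun _ : X => M) : affine (f * g) k = affine f (affine g k) := by
  simp [affine, mul_assoc]

theorem affine_inv_affine (f : (CoprodI fun _ : X => M) ⋊[permute X H M] H)
    (k : CoprodI fun _ : X => M) : affine f (affine f⁻¹ k) = k := by
  rw [← affine_mul, mul_inv_cancel]
  simp [affine]

theorem syllables_affine (f : (CoprodI fun _ : X => M) ⋊[permute X H M] H)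
    (p q : CoprodI fun _ : X => M) :
    syllables ((affine f p)⁻¹ * affine f q) = syllables (p⁻¹ * q) := by
  rw [← syllables_permute M f.right (p⁻¹ * q), affine, affine, map_mul, map_inv]
  congr 1
  group

/-- A finite subgroup of the semidirect product fixes an element of the free product, or stabilizes
a coset of one of the factors. -/
theorem exists_affine_fixed_or_coset
    (F : Subgroup ((CoprodI fun _ : X => M) ⋊[permute X H M] H)) [Finite F] :
    ∃ k : CoprodI fun _ : X => M, (∀ f ∈ F, affine f k = k) ∨
      ∃ x : X, ∀ f ∈ F, f.right • x = x ∧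
        ∃ m : M, affine f k = k * of (M := fun _ : X => M) (i := x) m := by
  classical
  have := Fintype.ofFinite F
  -- The radius about `p` of the orbit of `1`. It is invariant under `F`, and a minimum exists
  -- because its values are natural numbers.
  let R : (CoprodI fun _ : X => M) → ℕ := fun p =>
    Finset.univ.sup fun f : F => syllables (p⁻¹ * affine f.1 1)
  have hR : ∀ f ∈ F, ∀ p, R (affine f p) ≤ R p := by
    intro f hf p
    refine Finset.sup_le fun g _ => ?_
    have h := Finset.le_sup (f := fun f : F => syllables (p⁻¹ * affine f.1 1))
      (Finset.mem_univ (⟨f, hf⟩⁻¹ * g : F))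
    refine le_trans (le_of_eq ?_) h
    rw [← syllables_affine f p, Subgroup.coe_mul, affine_mul, Subgroup.coe_inv,
      affine_inv_affine]
  let p := Function.argmin R
  have hp : ∀ q, R p ≤ R q := fun q => Function.argmin_le R q
  have hmin : ∀ q, R q ≤ R p → ∀ r, R r ≤ R p → syllables (q⁻¹ * r) ≤ 1 := by
    intro q hq r hr
    by_contra hqr
    obtain ⟨c, hc⟩ := exists_syllables_lt_max (not_le.1 hqr)
    have hlt : R c < R p := by
      obtain ⟨f, -, hf⟩ := Finset.exists_mem_eq_sup Finset.univ ⟨(1 : F), Finset.mem_univ _⟩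
        fun f : F => syllables (c⁻¹ * affine f.1 1)
      have hle : ∀ s, syllables (s⁻¹ * affine f.1 1) ≤ R s := fun s =>
        Finset.le_sup (f := fun f : F => syllables (s⁻¹ * affine f.1 1)) (Finset.mem_univ f)
      calc R c = _ := hf
        _ < _ := hc _
        _ ≤ R p := max_le ((hle q).trans hq) ((hle r).trans hr)
    exact hlt.not_ge (hp c)
  refine ⟨p, or_iff_not_imp_left.2 fun hfix => ?_⟩
  push Not at hfix
  obtain ⟨g, hg, hgp⟩ := hfix
  have hgp1 : p⁻¹ * affine g p ≠ 1 := fun h => hgp (inv_mul_eq_one.1 h).symm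
  obtain h | ⟨x, m, hm, hgm⟩ := eq_of_of_syllables_le_one (hmin p le_rfl _ (hR g hg p))
  · exact absurd h hgp1
  -- The centres `p` and `g p` differ by a letter of factor `x`. Any other centre is within one
  -- syllable of both, which forces it into the same coset.
  have key : ∀ q, R q ≤ R p → ∃ n : M, q = p * of (M := fun _ : X => M) (i := x) n := by
    intro q hq
    obtain h | ⟨y, n, hn, hqn⟩ := eq_of_of_syllables_le_one (hmin p le_rfl q hq)
    · exact ⟨1, by rw [map_one, mul_one]; exact (inv_mul_eq_one.1 h).symm⟩
    · have h1 := hmin _ (hR g hg p) q hq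
      have h2 : (affine g p)⁻¹ * q = (of (M := fun _ : X => M) (i := x) m)⁻¹ *
          of (M := fun _ : X => M) (i := y) n := by
        rw [← hgm, ← hqn]; group
      rw [h2] at h1
      obtain rfl := idx_eq_of_of_inv_mul_of_syllables_le_one hm hn h1
      exact ⟨n, by rw [← hqn]; group⟩
  refine ⟨x, fun f hf => ⟨?_, key _ (hR f hf p)⟩⟩
  obtain ⟨a, ha⟩ := key _ (hR f hf p)
  obtain ⟨b, hb⟩ := key _ ((hR f hf _).trans (hR g hg p))
  -- The displacement between the images of `p` and `g p` is computed twice: by equivariance it is a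
  -- letter of factor `f.right • x`, and as both images are centres it is a letter of factor `x`.
  have h1 : (affine f p)⁻¹ * affine f (affine g p) =
      of (M := fun _ : X => M) (i := f.right • x) m := by
    rw [← permute_of, ← hgm, affine, affine, map_mul, map_inv]
    group
  have h2 : (affine f p)⁻¹ * affine f (affine g p) =
      of (M := fun _ : X => M) (i := x) (a⁻¹ * b) := by
    rw [ha, hb, map_mul, map_inv]
    group
  rw [h1] at h2
  have hab : a⁻¹ * b ≠ 1 := by
    intro h
    rw [h, map_one] at h2
    have := congrArg syllables h2
    rw [syllables_of hm, syllables_one] at this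
    exact one_ne_zero this
  refine idx_eq_of_of_inv_mul_of_syllables_le_one (N := fun _ : X => M) hm hab ?_
  rw [h2, inv_mul_cancel, syllables_one]
  exact zero_le_one

end Permute

end Monoid.CoprodI

/-! ### Graph products: universal property, retractions and projections. -/

namespace GraphProduct

variable {V : Type*} {Γ : SimpleGraph V} {G : V → Type*} [∀ v, Group (G v)]

/-- The universal property of the graph product. -/
def lift {P : Type*} [Group P] (f : ∀ v, G v →* P)
    (hf : ∀ u v, Γ.Adj u v → ∀ (g : G u) (h : G v), Commute (f u g) (f v h)) :
    GraphProduct Γ G →* P :=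
  QuotientGroup.lift _ (Monoid.CoprodI.lift f) <| by
    refine Subgroup.normalClosure_le_normal ?_
    rintro _ ⟨u, v, huv, g, h, rfl⟩
    simp only [SetLike.mem_coe, MonoidHom.mem_ker, map_mul, map_inv, Monoid.CoprodI.lift_of]
    rw [mul_assoc, (hf u v huv g h).eq]
    group

theorem lift_of {P : Type*} [Group P] (f : ∀ v, G v →* P)
    (hf : ∀ u v, Γ.Adj u v → ∀ (g : G u) (h : G v), Commute (f u g) (f v h)) (v : V) (g : G v) :
    lift f hf (of Γ G v g) = f v g :=
  Monoid.CoprodI.lift_of f g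

theorem hom_ext {P : Type*} [Group P] {f g : GraphProduct Γ G →* P}
    (h : ∀ v (x : G v), f (of Γ G v x) = g (of Γ G v x)) : f = g :=
  QuotientGroup.monoidHom_ext _ <| Monoid.CoprodI.ext_hom _ _ fun v => MonoidHom.ext (h v)

theorem sub_le_iff {A : Set V} {K : Subgroup (GraphProduct Γ G)} :
    sub Γ G A ≤ K ↔ ∀ a ∈ A, ∀ g : G a, of Γ G a g ∈ K := by
  simp [sub, Subgroup.closure_le, Set.range_subset_iff]

theorem of_mem_sub {A : Set V} {a : V} (ha : a ∈ A) (g : G a) : of Γ G a g ∈ sub Γ G A :=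
  sub_le_iff.1 le_rfl a ha g

theorem sub_mono {A B : Set V} (h : A ⊆ B) : sub Γ G A ≤ sub Γ G B :=
  sub_le_iff.2 fun _ ha g => of_mem_sub (h ha) g

theorem sub_univ : sub Γ G Set.univ = ⊤ := by
  refine top_unique fun z _ => ?_
  obtain ⟨k, rfl⟩ := QuotientGroup.mk'_surjective _ z
  induction k using Monoid.CoprodI.induction_on with
  | one => exact one_mem _
  | of v g => exact of_mem_sub (Set.mem_univ v) g
  | mul x y hx hy =>
    rw [map_mul]
    exact mul_mem (hx trivial) (hy trivial)

theorem commute_of_mem_sub {A : Set V} {v : V} (hA : ∀ a ∈ A, Γ.Adj v a) (g : G v)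
    {z : GraphProduct Γ G} (hz : z ∈ sub Γ G A) : Commute (of Γ G v g) z := by
  have h : sub Γ G A ≤ Subgroup.centralizer {of Γ G v g} :=
    sub_le_iff.2 fun a ha x => Subgroup.mem_centralizer_singleton_iff.2
      (commute_of_adj (hA a ha) g x).symm
  exact (Subgroup.mem_centralizer_singleton_iff.1 (h hz)).symm

theorem exists_eq_of_mul_of_mem_sub_insert {A : Set V} {v : V} (hA : ∀ a ∈ A, Γ.Adj v a)
    {z : GraphProduct Γ G} (hz : z ∈ sub Γ G (insert v A)) :
    ∃ g : G v, ∃ y ∈ sub Γ G A, z = of Γ G v g * y := by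
  induction hz using Subgroup.closure_induction with
  | mem x hx =>
    simp only [Set.mem_iUnion] at hx
    obtain ⟨b, rfl | hb, g, rfl⟩ := hx
    · exact ⟨g, 1, one_mem _, (mul_one _).symm⟩
    · exact ⟨1, _, of_mem_sub hb g, by rw [map_one, one_mul]⟩
  | one => exact ⟨1, 1, one_mem _, by rw [map_one, one_mul]⟩
  | mul x y _ _ hx hy =>
    obtain ⟨g, a, ha, rfl⟩ := hx
    obtain ⟨h, b, hb, rfl⟩ := hy
    refine ⟨g * h, a * b, mul_mem ha hb, ?_⟩
    rw [map_mul, mul_assoc, ← mul_assoc a, ← (commute_of_mem_sub hA h ha).eq]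
    simp only [mul_assoc]
  | inv x _ hx =>
    obtain ⟨g, a, ha, rfl⟩ := hx
    refine ⟨g⁻¹, a⁻¹, inv_mem ha, ?_⟩
    rw [mul_inv_rev, map_inv, (commute_of_mem_sub hA g ha).inv_inv.eq]

section Retract

open Classical in
/-- The retraction of the graph product onto `G(W)` that kills the other vertex groups. -/
noncomputable def retract (W : Set V) : GraphProduct Γ G →* GraphProduct Γ G :=
  lift (fun u => if u ∈ W then of Γ G u else 1) fun u v huv g h => by
    split_ifs
    · exact commute_of_adj huv g h
    · exact Commute.one_right _
    · exact Commute.one_left _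
    · exact Commute.one_left _

theorem retract_of_mem {W : Set V} {v : V} (hv : v ∈ W) (g : G v) :
    retract W (of Γ G v g) = of Γ G v g := by
  rw [retract, lift_of, if_pos hv]

theorem retract_of_notMem {W : Set V} {v : V} (hv : v ∉ W) (g : G v) :
    retract W (of Γ G v g) = 1 := by
  rw [retract, lift_of, if_neg hv, MonoidHom.one_apply]

theorem retract_eq_self {W : Set V} {z : GraphProduct Γ G} (hz : z ∈ sub Γ G W) :
    retract W z = z := by
  have h : sub Γ G W ≤ MonoidHom.eqLocus (retract W) (MonoidHom.id _) :=
    sub_le_iff.2 fun a ha g => retract_of_mem ha g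
  exact h hz

theorem retract_mem_inter {W A : Set V} {z : GraphProduct Γ G} (hz : z ∈ sub Γ G A) :
    retract W z ∈ sub Γ G (A ∩ W) := by
  have h : sub Γ G A ≤ (sub Γ G (A ∩ W)).comap (retract W) :=
    sub_le_iff.2 fun a ha g => by
      rw [Subgroup.mem_comap]
      by_cases haW : a ∈ W
      · rw [retract_of_mem haW]
        exact of_mem_sub (A := A ∩ W) ⟨ha, haW⟩ g
      · rw [retract_of_notMem haW]
        exact one_mem _
  exact h hz

theorem retract_mem (W : Set V) (z : GraphProduct Γ G) : retract W z ∈ sub Γ G W := by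
  have h := retract_mem_inter (W := W) (A := Set.univ) (z := z) (by rw [sub_univ]; trivial)
  rwa [Set.univ_inter] at h

end Retract

section Proj

open Classical in
/-- The retraction of the graph product onto a vertex group. -/
noncomputable def proj (a : V) : GraphProduct Γ G →* G a :=
  lift (Pi.mulSingle (M := fun u => G u →* G a) a (MonoidHom.id (G a))) fun u v huv g h => by
    by_cases hu : u = a
    · have hv : v ≠ a := fun hv => huv.ne (hu.trans hv.symm)
      rw [Pi.mulSingle_eq_of_ne hv]
      exact Commute.one_right _
    · rw [Pi.mulSingle_eq_of_ne hu]
      exact Commute.one_left _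

theorem proj_of_self (a : V) (g : G a) : proj a (of Γ G a g) = g := by
  classical
  rw [proj, lift_of, Pi.mulSingle_eq_same, MonoidHom.id_apply]

theorem proj_of_ne {a b : V} (hb : b ≠ a) (g : G b) : proj a (of Γ G b g) = 1 := by
  classical
  rw [proj, lift_of, Pi.mulSingle_eq_of_ne hb, MonoidHom.one_apply]

theorem proj_eq_one_of_mem_sub {A : Set V} {a : V} (ha : a ∉ A) {z : GraphProduct Γ G}
    (hz : z ∈ sub Γ G A) : proj a z = 1 := by
  have h : sub Γ G A ≤ (proj a).ker :=
    sub_le_iff.2 fun b hb g => proj_of_ne (fun hba : b = a => ha (hba ▸ hb)) g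
  exact h hz

/-- For complete `C` the group `G(C)` is a direct product: split off one vertex letter at a time,
each detected by its projection. -/
theorem eq_one_of_forall_proj_eq_one [Finite V] {C : Set V} (hC : Γ.IsClique C)
    {z : GraphProduct Γ G} (hz : z ∈ sub Γ G C) (h : ∀ c ∈ C, proj c z = 1) : z = 1 := by
  induction C, C.toFinite using Set.Finite.induction_on generalizing z with
  | empty => simpa [sub] using hz
  | @insert a s ha hs ih =>
    have hadj : ∀ b ∈ s, Γ.Adj a b := fun b hb =>
      hC (Set.mem_insert a s) (Set.mem_insert_of_mem a hb) fun hab => ha (hab ▸ hb)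
    obtain ⟨g, y, hy, rfl⟩ := exists_eq_of_mul_of_mem_sub_insert hadj hz
    have hg := h a (Set.mem_insert a s)
    rw [map_mul, proj_of_self, proj_eq_one_of_mem_sub ha hy, mul_one] at hg
    rw [hg, map_one, one_mul] at h ⊢
    exact ih (hC.subset (Set.subset_insert a s)) hy
      fun c hc => h c (Set.mem_insert_of_mem a hc)

end Proj

/-! ### Splitting off a vertex by a semidirect product. -/

section Splitting

open Monoid

variable {W : Set V} {v : V}

/-- The vertices of `W` adjacent to `v`. -/
def link (Γ : SimpleGraph V) (W : Set V) (v : V) : Set V := W ∩ Γ.neighborSet v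

theorem adj_of_mem_link {a : V} (ha : a ∈ link Γ W v) : Γ.Adj v a := ha.2

variable (Γ G W v)

/-- The index set of the copies of `G v`: the cosets of the subgroup generated by the link. -/
abbrev LinkCosets := GraphProduct Γ G ⧸ sub Γ G (link Γ W v)

/-- The semidirect product of a free product of copies of `G v` by the graph product. -/
abbrev Split := (CoprodI fun _ : LinkCosets Γ G W v => G v) ⋊[
  CoprodI.permute (LinkCosets Γ G W v) (GraphProduct Γ G) (G v)] GraphProduct Γ G

variable {Γ G W v}

/-- The subgroup of the link fixes the trivial coset, so it acts trivially on that copy of `G v`.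
This is the relation needed to define `toSplit`. -/
theorem commute_inr_inl {z : GraphProduct Γ G} (hz : z ∈ sub Γ G (link Γ W v)) (m : G v) :
    Commute (SemidirectProduct.inr z : Split Γ G W v)
      (SemidirectProduct.inl (CoprodI.of (M := fun _ : LinkCosets Γ G W v => G v)
        (i := ((1 : GraphProduct Γ G) : LinkCosets Γ G W v)) m)) := by
  have h : z • ((1 : GraphProduct Γ G) : LinkCosets Γ G W v) = (1 : GraphProduct Γ G) := by
    change ((z * 1 : GraphProduct Γ G) : LinkCosets Γ G W v) = _
    rw [mul_one]
    exact QuotientGroup.eq.2 (by rw [mul_one]; exact inv_mem hz)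
  rw [Commute, SemiconjBy]
  have h2 := SemidirectProduct.inl_aut
    (φ := CoprodI.permute (LinkCosets Γ G W v) (GraphProduct Γ G) (G v)) z
    (CoprodI.of (M := fun _ : LinkCosets Γ G W v => G v)
        (i := ((1 : GraphProduct Γ G) : LinkCosets Γ G W v)) m)
  rw [CoprodI.permute_of, h] at h2
  rw [map_inv] at h2
  exact (eq_mul_inv_iff_mul_eq.1 h2).symm

open Classical in
/-- The embedding of `G(W ∪ {v})` into the semidirect product. -/
noncomputable def toSplit : GraphProduct Γ G →* Split Γ G W v :=
  lift (fun u => if u ∈ W then SemidirectProduct.inr.comp (of Γ G u) else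
    Pi.mulSingle (M := fun u => G u →* Split Γ G W v) v
      (SemidirectProduct.inl.comp (CoprodI.of (M := fun _ : LinkCosets Γ G W v => G v)
        (i := ((1 : GraphProduct Γ G) : LinkCosets Γ G W v)))) u) <| by
    have key : ∀ a b, Γ.Adj a b → a ∈ W → b ∉ W → ∀ (g : G a) (h : G b),
        Commute ((SemidirectProduct.inr : _ →* Split Γ G W v).comp (of Γ G a) g)
          (Pi.mulSingle (M := fun u => G u →* Split Γ G W v) v
      (SemidirectProduct.inl.comp (CoprodI.of (M := fun _ : LinkCosets Γ G W v => G v)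
        (i := ((1 : GraphProduct Γ G) : LinkCosets Γ G W v)))) b h) := by
      intro a b hab ha hb g h
      by_cases hbv : b = v
      · subst hbv
        rw [Pi.mulSingle_eq_same]
        exact commute_inr_inl (of_mem_sub (A := link Γ W b) ⟨ha, hab.symm⟩ g) h
      · rw [Pi.mulSingle_eq_of_ne hbv]
        exact Commute.one_right _
    intro a b hab g h
    split_ifs with ha hb hb
    · exact Commute.map (commute_of_adj hab g h : Commute _ _) SemidirectProduct.inr
    · exact key a b hab ha hb g h
    · exact (key b a hab.symm hb ha h g).symm
    · by_cases hbv : b = v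
      · rw [Pi.mulSingle_eq_of_ne (fun hav => hab.ne (hav.trans hbv.symm))]
        exact Commute.one_left _
      · rw [Pi.mulSingle_eq_of_ne hbv]
        exact Commute.one_right _

theorem toSplit_of_mem {u : V} (hu : u ∈ W) (g : G u) :
    (toSplit (of Γ G u g) : Split Γ G W v) = SemidirectProduct.inr (of Γ G u g) := by
  rw [toSplit, lift_of, if_pos hu, MonoidHom.comp_apply]

theorem toSplit_of_self (hv : v ∉ W) (g : G v) :
    (toSplit (of Γ G v g) : Split Γ G W v) = SemidirectProduct.inl
      (CoprodI.of (M := fun _ : LinkCosets Γ G W v => G v)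
        (i := ((1 : GraphProduct Γ G) : LinkCosets Γ G W v)) g) := by
  classical
  rw [toSplit, lift_of, if_neg hv, Pi.mulSingle_eq_same, MonoidHom.comp_apply]

theorem toSplit_of_notMem {u : V} (hu : u ∉ W) (huv : u ≠ v) (g : G u) :
    (toSplit (of Γ G u g) : Split Γ G W v) = 1 := by
  classical
  rw [toSplit, lift_of, if_neg hu, Pi.mulSingle_eq_of_ne huv, MonoidHom.one_apply]

theorem right_toSplit (hv : v ∉ W) (z : GraphProduct Γ G) :
    (toSplit z : Split Γ G W v).right = retract W z := by
  have h : SemidirectProduct.rightHom.comp (toSplit (Γ := Γ) (G := G) (W := W) (v := v)) =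
      retract W := by
    refine hom_ext fun u g => ?_
    rw [MonoidHom.comp_apply]
    by_cases hu : u ∈ W
    · rw [toSplit_of_mem hu, retract_of_mem hu, SemidirectProduct.rightHom_inr]
    · rw [retract_of_notMem hu]
      by_cases huv : u = v
      · subst huv
        rw [toSplit_of_self hu, SemidirectProduct.rightHom_inl]
      · rw [toSplit_of_notMem hu huv, map_one]
  exact DFunLike.congr_fun h z

/-- The map of the free product of copies of `G v` onto the conjugates of `G v`. -/
noncomputable def conjugates : (CoprodI fun _ : LinkCosets Γ G W v => G v) →* GraphProduct Γ G :=
  CoprodI.lift fun x => (MulAut.conj x.out).toMonoidHom.comp (of Γ G v)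

theorem conjugates_of (x : LinkCosets Γ G W v) (m : G v) :
    conjugates (CoprodI.of (M := fun _ : LinkCosets Γ G W v => G v) (i := x) m) =
      x.out * of Γ G v m * x.out⁻¹ := by
  rw [conjugates, CoprodI.lift_of]
  simp

/-- Representatives of a coset differ by an element of `G(link)`, which commutes with `G v`. -/
theorem conj_out_eq (y : GraphProduct Γ G) (m : G v) :
    (y : LinkCosets Γ G W v).out * of Γ G v m * (y : LinkCosets Γ G W v).out⁻¹ =
      y * of Γ G v m * y⁻¹ := by
  obtain ⟨s, hs⟩ := QuotientGroup.mk_out_eq_mul (sub Γ G (link Γ W v)) y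
  rw [hs, mul_assoc y, ← (commute_of_mem_sub (fun _ => adj_of_mem_link) m s.2).eq]
  group

/-- The left inverse of the embedding `toSplit`. -/
noncomputable def ofSplit : Split Γ G W v →* GraphProduct Γ G :=
  SemidirectProduct.lift conjugates (MonoidHom.id _) fun y => by
    refine CoprodI.ext_hom _ _ fun x => MonoidHom.ext fun m => ?_
    simp only [MonoidHom.comp_apply, MulEquiv.coe_toMonoidHom, MonoidHom.id_apply,
      MulAut.conj_apply]
    rw [CoprodI.permute_of, conjugates_of, conjugates_of]
    have h : y • x = ((y * x.out : GraphProduct Γ G) : LinkCosets Γ G W v) := by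
      conv_lhs => rw [← QuotientGroup.out_eq' x]
      rfl
    rw [h, conj_out_eq]
    group

theorem ofSplit_toSplit (hv : v ∉ W) {z : GraphProduct Γ G} (hz : z ∈ sub Γ G (insert v W)) :
    ofSplit (toSplit z : Split Γ G W v) = z := by
  have h : sub Γ G (insert v W) ≤ MonoidHom.eqLocus
      (ofSplit.comp (toSplit (Γ := Γ) (G := G) (W := W) (v := v))) (MonoidHom.id _) := by
    refine sub_le_iff.2 fun u hu g => ?_
    change ofSplit (toSplit (of Γ G u g) : Split Γ G W v) = of Γ G u g
    obtain rfl | hu := hu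
    · rw [toSplit_of_self hv, ofSplit, SemidirectProduct.lift_inl, conjugates_of, conj_out_eq]
      group
    · rw [toSplit_of_mem hu, ofSplit, SemidirectProduct.lift_inr, MonoidHom.id_apply]
  exact h hz

/-- Translates the affine action back into conjugation: the hypothesis is an equation between
products in the semidirect product, to which `ofSplit` is applied. -/
theorem conj_eq_of_affine (hv : v ∉ W) {z : GraphProduct Γ G} (hz : z ∈ sub Γ G (insert v W))
    (k n : CoprodI fun _ : LinkCosets Γ G W v => G v)
    (h : CoprodI.affine (toSplit z : Split Γ G W v) k = k * n) :
    (conjugates k)⁻¹ * z * conjugates k = conjugates n * retract W z := by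
  have h1 : (toSplit z : Split Γ G W v) * SemidirectProduct.inl k =
      SemidirectProduct.inl (k * n) * SemidirectProduct.inr (retract W z) := by
    rw [← h, ← right_toSplit hv]
    ext <;> simp [CoprodI.affine]
  have h2 := congrArg ofSplit h1
  rw [map_mul, map_mul, ofSplit_toSplit hv hz, ofSplit, SemidirectProduct.lift_inl,
    SemidirectProduct.lift_inl, SemidirectProduct.lift_inr, MonoidHom.id_apply, map_mul] at h2
  rw [mul_assoc, h2]
  group

/-- A finite subgroup of `G(W ∪ {v})` is conjugate into `G(W)` or into the subgroup generated by
the star of `v`. -/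
theorem exists_conj_mem_sub_or_star (hv : v ∉ W) (F : Subgroup (GraphProduct Γ G)) [Finite F]
    (hF : F ≤ sub Γ G (insert v W)) :
    ∃ g : GraphProduct Γ G, (∀ f ∈ F, g⁻¹ * f * g ∈ sub Γ G W) ∨
      ∀ f ∈ F, g⁻¹ * f * g ∈ sub Γ G (insert v (link Γ W v)) := by
  have hfin : Finite (F.map (toSplit (W := W) (v := v))) :=
    ((Set.toFinite (F : Set (GraphProduct Γ G))).image _).to_subtype
  obtain ⟨k, hk | ⟨x, hx⟩⟩ :=
    CoprodI.exists_affine_fixed_or_coset (F.map (toSplit (W := W) (v := v)))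
  · refine ⟨conjugates k, Or.inl fun f hf => ?_⟩
    rw [conj_eq_of_affine hv (hF hf) k 1 (by
      rw [hk _ (Subgroup.mem_map_of_mem _ hf), mul_one]), map_one, one_mul]
    exact retract_mem W f
  -- The extra factor `x.out` moves copy `x` to the trivial coset, turning its stabilizer into
  -- `G(link)` and its conjugate of `G v` into `G v` itself.
  · refine ⟨conjugates k * x.out, Or.inr fun f hf => ?_⟩
    obtain ⟨hfx, m, hm⟩ := hx _ (Subgroup.mem_map_of_mem _ hf)
    have h := conj_eq_of_affine hv (hF hf) k _ hm
    rw [conjugates_of] at h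
    rw [right_toSplit hv] at hfx
    have hstab : x.out⁻¹ * retract W f * x.out ∈ sub Γ G (link Γ W v) := by
      have h3 : (x.out : LinkCosets Γ G W v) = (retract W f * x.out : GraphProduct Γ G) := by
        rw [← QuotientGroup.out_eq' x] at hfx
        exact hfx.symm
      rw [mul_assoc]
      exact QuotientGroup.eq.1 h3
    have h2 : (conjugates k * x.out)⁻¹ * f * (conjugates k * x.out) =
        of Γ G v m * (x.out⁻¹ * retract W f * x.out) := by
      calc _ = x.out⁻¹ * ((conjugates k)⁻¹ * f * conjugates k) * x.out := by group
        _ = _ := by rw [h]; group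
    rw [h2]
    exact mul_mem (of_mem_sub (Set.mem_insert v _) m) (sub_mono (Set.subset_insert v _) hstab)

end Splitting

end GraphProduct

/-! ### Finite subgroups and complete sets. -/

namespace GraphProduct

variable {V : Type*} {Γ : SimpleGraph V} {G : V → Type*} [∀ v, Group (G v)]

/-- A finite subgroup of `G(W)`, for `W` finite, is conjugate into `G(C)` for some complete `C`. -/
theorem exists_conj_mem_sub_clique {W : Set V} (hW : W.Finite) (F : Subgroup (GraphProduct Γ G))
    [Finite F] (hF : F ≤ sub Γ G W) :
    ∃ (g : GraphProduct Γ G) (C : Set V), Γ.IsClique C ∧ ∀ f ∈ F, g⁻¹ * f * g ∈ sub Γ G C := by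
  induction W, hW using Set.Finite.induction_on generalizing F with
  | empty =>
    refine ⟨1, ∅, Set.pairwise_empty _, fun f hf => ?_⟩
    rw [inv_one, one_mul, mul_one]
    exact hF hf
  | @insert v W hv hW ih =>
    obtain ⟨g, h | h⟩ := exists_conj_mem_sub_or_star hv F hF
    · have : Finite (F.map (MulAut.conj g⁻¹).toMonoidHom) :=
        ((Set.toFinite (F : Set (GraphProduct Γ G))).image _).to_subtype
      obtain ⟨k, C, hC, hk⟩ := ih (F.map (MulAut.conj g⁻¹).toMonoidHom) (by
        rintro _ ⟨f, hf, rfl⟩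
        simpa using h f hf)
      refine ⟨g * k, C, hC, fun f hf => ?_⟩
      simpa [mul_assoc] using hk _ (Subgroup.mem_map_of_mem _ hf)
    · let φ : GraphProduct Γ G →* GraphProduct Γ G :=
        (retract (link Γ W v)).comp (MulAut.conj g⁻¹).toMonoidHom
      have hφ : ∀ f, φ f = retract (link Γ W v) (g⁻¹ * f * g) := fun f => by simp [φ]
      have : Finite (F.map φ) :=
        ((Set.toFinite (F : Set (GraphProduct Γ G))).image φ).to_subtype
      obtain ⟨k, C, hC, hk⟩ := ih (F.map φ) (by
        rintro _ ⟨f, -, rfl⟩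
        exact sub_mono Set.inter_subset_left (retract_mem (link Γ W v) _))
      -- The induction hypothesis need not give `k` and `C` inside the link, so both are cut down to
      -- it. The retracted `k` then commutes with `G v` and conjugates only the link component.
      refine ⟨g * retract (link Γ W v) k, insert v (C ∩ link Γ W v),
        (hC.subset Set.inter_subset_left).insert fun a ha _ => adj_of_mem_link ha.2,
        fun f hf => ?_⟩
      obtain ⟨m, y, hy, hfy⟩ :=
        exists_eq_of_mul_of_mem_sub_insert (fun _ => adj_of_mem_link) (h f hf)
      have hv' : v ∉ link Γ W v := fun h => hv h.1
      have hφf : φ f = y := by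
        rw [hφ, hfy, map_mul, retract_of_notMem hv', retract_eq_self hy, one_mul]
      have hmem := retract_mem_inter (W := link Γ W v) (hk _ (Subgroup.mem_map_of_mem φ hf))
      rw [hφf, map_mul, map_mul, map_inv, retract_eq_self hy] at hmem
      have hcomm := commute_of_mem_sub (fun _ => adj_of_mem_link) m (retract_mem (link Γ W v) k)
      have heq : (g * retract (link Γ W v) k)⁻¹ * f * (g * retract (link Γ W v) k) =
          of Γ G v m * ((retract (link Γ W v) k)⁻¹ * y * retract (link Γ W v) k) := by
        calc _ = (retract (link Γ W v) k)⁻¹ * (g⁻¹ * f * g) * retract (link Γ W v) k := by group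
          _ = ((retract (link Γ W v) k)⁻¹ * of Γ G v m) * y * retract (link Γ W v) k := by
            rw [hfy]; group
          _ = _ := by rw [← hcomm.inv_right.eq]; group
      rw [heq]
      exact mul_mem (of_mem_sub (Set.mem_insert v _) m) (sub_mono (Set.subset_insert v _) hmem)

/-- If a subgroup of `G(C)`, with `C` complete, contains a conjugate of a nontrivial vertex group,
then the vertex is in `C` and the subgroup contains the vertex group. -/
theorem mem_and_of_mem_of_conj_mem [Finite V] {C : Set V} (hC : Γ.IsClique C) {a : V}
    [Nontrivial (G a)] {F : Subgroup (GraphProduct Γ G)} (hF : F ≤ sub Γ G C)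
    {g : GraphProduct Γ G} (h : ∀ m : G a, g⁻¹ * of Γ G a m * g ∈ F) :
    a ∈ C ∧ ∀ m : G a, of Γ G a m ∈ F := by
  have haC : a ∈ C := by
    by_contra haC
    obtain ⟨m, hm⟩ := exists_ne (1 : G a)
    have h1 := proj_eq_one_of_mem_sub haC (hF (h m))
    rw [map_mul, map_mul, proj_of_self, map_inv] at h1
    exact hm (by simpa using (conj_eq_one_iff (a := (proj a g)⁻¹) (b := m)).1 (by simpa using h1))
  refine ⟨haC, fun m => ?_⟩
  -- Pre-conjugating `m` cancels the effect of `g` in coordinate `a`; all other coordinates are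
  -- trivial, so the conjugate is exactly `of Γ G a m`.
  have hmem := h (proj a g * m * (proj a g)⁻¹)
  suffices heq : g⁻¹ * of Γ G a (proj a g * m * (proj a g)⁻¹) * g = of Γ G a m from heq ▸ hmem
  refine mul_inv_eq_one.1 (eq_one_of_forall_proj_eq_one hC
    (mul_mem (hF hmem) (inv_mem (of_mem_sub haC m))) fun c _ => ?_)
  simp only [map_mul (proj (Γ := Γ) (G := G) c), map_inv (proj (Γ := Γ) (G := G) c)]
  by_cases hc : a = c
  · subst hc
    rw [proj_of_self, proj_of_self]
    group
  · rw [proj_of_ne hc, proj_of_ne hc]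
    group

/-! ### Upper bounds in the poset of classes. -/

variable [Finite V]

/-- Every class of finite subgroups has a representative in `G(C)` for some complete `C`. -/
theorem exists_eq_mk_le_sub_clique (x : FinSubgroupClass (GraphProduct Γ G)) :
    ∃ (F : Subgroup (GraphProduct Γ G)) (hF : Finite F) (C : Set V), Γ.IsClique C ∧
      F ≤ sub Γ G C ∧ x = FinSubgroupClass.mk F hF := by
  obtain ⟨⟨F, hF⟩⟩ := x
  obtain ⟨g, C, hC, hg⟩ :=
    exists_conj_mem_sub_clique Set.finite_univ F (by rw [sub_univ]; exact le_top)
  have hF' : Finite (F.map (MulAut.conj g⁻¹).toMonoidHom) :=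
    ((Set.toFinite (F : Set (GraphProduct Γ G))).image _).to_subtype
  refine ⟨F.map (MulAut.conj g⁻¹).toMonoidHom, hF', C, hC, ?_, ?_⟩
  · rintro _ ⟨f, hf, rfl⟩
    simpa using hg f hf
  · refine Quotient.sound (s := conjFinSetoid _) ⟨g, ?_⟩
    rw [map_conj_map_conj, mul_inv_cancel, map_conj_one]

theorem cls_mono [∀ v, Finite (G v)] {A B : Set V} (hA : Γ.IsClique A) (hB : Γ.IsClique B)
    (h : A ⊆ B) : cls Γ G A hA ≤ cls Γ G B hB :=
  (FinSubgroupClass.mk_le_mk _ _).2 ⟨1, by rw [map_conj_one]; exact sub_mono h⟩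

/-- The conjugator disappears from the conclusion, so two lower bounds of `[F]` with unrelated
conjugators can be compared inside the same `F`. -/
theorem subset_and_sub_le_of_cls_le [∀ v, Finite (G v)] [∀ v, Nontrivial (G v)]
    {A C : Set V} (hA : Γ.IsClique A) (hC : Γ.IsClique C) {F : Subgroup (GraphProduct Γ G)} (hfin : Finite F)
    (hF : F ≤ sub Γ G C) (h : cls Γ G A hA ≤ FinSubgroupClass.mk F hfin) :
    A ⊆ C ∧ sub Γ G A ≤ F := by
  obtain ⟨g, hg⟩ := (FinSubgroupClass.mk_le_mk _ _).1 h
  have key : ∀ a ∈ A, a ∈ C ∧ ∀ m : G a, of Γ G a m ∈ F := fun a ha =>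
    mem_and_of_mem_of_conj_mem (g := g) hC hF fun m => by
      obtain ⟨f, hf, hfm⟩ := hg (of_mem_sub ha m)
      rw [← hfm]
      simpa [mul_assoc] using hf
  exact ⟨fun a ha => (key a ha).1, sub_le_iff.2 fun a ha => (key a ha).2⟩

end GraphProduct

theorem mainTheorem6 {V : Type*} [Finite V] (Γ : SimpleGraph V) (G : V → Type*)
    [∀ v, Group (G v)] [∀ v, Finite (G v)] [∀ v, Nontrivial (G v)]
    (A B : Set V) (hA : Γ.IsClique A) (hB : Γ.IsClique B) :
    (∀ hAB : Γ.IsClique (A ∪ B),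
      IsLUB {GraphProduct.cls Γ G A hA, GraphProduct.cls Γ G B hB}
        (GraphProduct.cls Γ G (A ∪ B) hAB)) ∧
    (¬ Γ.IsClique (A ∪ B) →
      ¬ ∃ x : FinSubgroupClass (GraphProduct Γ G),
        GraphProduct.cls Γ G A hA ≤ x ∧ GraphProduct.cls Γ G B hB ≤ x) := by
  refine ⟨fun hAB => ⟨?_, ?_⟩, ?_⟩
  · rintro _ (rfl | rfl)
    · exact GraphProduct.cls_mono _ _ Set.subset_union_left
    · exact GraphProduct.cls_mono _ _ Set.subset_union_right
  · intro x hx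
    obtain ⟨F, hfin, C, hC, hF, rfl⟩ := GraphProduct.exists_eq_mk_le_sub_clique x
    have h1 := GraphProduct.subset_and_sub_le_of_cls_le hA hC hfin hF (hx (Set.mem_insert _ _))
    have h2 := GraphProduct.subset_and_sub_le_of_cls_le hB hC hfin hF
      (hx (Set.mem_insert_of_mem _ rfl))
    refine (FinSubgroupClass.mk_le_mk _ _).2 ⟨1, ?_⟩
    rw [map_conj_one]
    refine GraphProduct.sub_le_iff.2 ?_
    rintro a (ha | ha) g
    · exact h1.2 (GraphProduct.of_mem_sub ha g)
    · exact h2.2 (GraphProduct.of_mem_sub ha g)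
  · rintro hAB ⟨x, hxA, hxB⟩
    obtain ⟨F, hfin, C, hC, hF, rfl⟩ := GraphProduct.exists_eq_mk_le_sub_clique x
    exact hAB (hC.subset (Set.union_subset
      (GraphProduct.subset_and_sub_le_of_cls_le hA hC hfin hF hxA).1
      (GraphProduct.subset_and_sub_le_of_cls_le hB hC hfin hF hxB).1))
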